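/- Let $T, N\ge 1$ and let $D$ be a probability distribution on $\mathbb{R}^N\times\{-1,+1\}$. Run the Perceptron algorithm on a sample $S=((x_1,y_1),\dots,(x_T,y_T))$: $w_1=0$, and for $t=1,\dots,T$, $w_{t+1}=w_t+y_tx_t$ if $\operatorname{sgn}(w_t\cdot x_t)\ne y_t$, and $w_{t+1}=w_t$ otherwise (any fixed value may be assigned to $\operatorname{sgn}(0)$). Let $I\subseteq\{1,\dots,T\}$ be the set of rounds at which an update is made. For $\gamma>0$, call $\phi:\mathbb{R}\to\mathbb{R}$ $\gamma$-admissible if it is convex, non-negative, satisfies $\phi(0)>0$, and $|\phi(a)-\phi(b)|\le\gamma|a-b|$ for all $a,b\in\mathbb{R}$. Let $\ell(w;x,y)\in\{0,1\}$ be the zero-one loss, either of the prediction ($\ell=1$ iff $\operatorname{sgn}(w\cdot x)\ne y$) or of the score ($\ell=1$ iff $y(w\cdot x)<0$); the result holds for both. For $\delta>0$, a penalized risk minimizing Perceptron hypothesis is $\hat w=w_{i^*}$ with $$i^*\in\operatorname*{argmin}_{1\le i\le T}\ \frac{1}{T-i+1}\sum_{t=i}^T\ell(w_i;x_t,y_t)+\sqrt{\frac{\log\frac{T(T+1)}{\delta}}{2(T-i+1)}}.$$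 Then, for every $\delta>0$, if $S$ is drawn i.i.d. according to $D$, with probability at least $1-\delta$ over $S$ the following holds (for every choice of the minimizer $i^*$): $$\Pr_{(x,y)\sim D}\big[y(\hat w\cdot x)<0\big]\le\inf_{\gamma,\phi,u}\left(\frac{\sum_{t\in I}\phi(y_t(u\cdot x_t))}{\phi(0)\,T}+\frac{\gamma\sqrt{\sum_{t\in I}\|x_t\|^2}}{\phi(0)\,T}\right)+6\sqrt{\frac1T\log\frac{2(T+1)}{\delta}},$$ where the infimum is over all $\gamma>0$, all $\gamma$-admissible $\phi$ and all $u\in\mathbb{R}^N$ with $\|u\|\le1$, and $\|\cdot\|$ is the Euclidean norm. (For $\delta\ge1$ the claim is void.) -/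

import Mathlib

open MeasureTheory

noncomputable section

namespace Perceptron

/-- The instance space `ℝ^N` with its Euclidean norm and inner product. -/
abbrev Vec (N : ℕ) : Type := EuclideanSpace ℝ (Fin N)

/-- The sign function; `s₀` is the value assigned to it at `0`
(conventions differ: `1`, `-1` and `0` are all in use). -/
def sgn (s₀ z : ℝ) : ℝ := if 0 < z then 1 else if z < 0 then -1 else s₀

/-- The hypothesis `w` errs on the labelled example `p = (x, y)`: `sgn (w · x) ≠ y`. -/
def Errs {N : ℕ} (s₀ : ℝ) (w : Vec N) (p : Vec N × ℝ) : Prop :=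
  sgn s₀ (inner ℝ w p.1) ≠ p.2

open Classical in
/-- One round of the Perceptron algorithm: add `y x` on a mistake, otherwise do nothing. -/
def step {N : ℕ} (s₀ : ℝ) (w : Vec N) (p : Vec N × ℝ) : Vec N :=
  if Errs s₀ w p then w + p.2 • p.1 else w

/-- The Perceptron weight vectors on the sample `S`, started at `0`. Rounds are counted from `0`:
`weight s₀ S t` is the vector used for prediction in round `t < T`. -/
def weight {N T : ℕ} (s₀ : ℝ) (S : Fin T → Vec N × ℝ) : ℕ → Vec N
  | 0 => 0
  | t + 1 => if h : t < T then step s₀ (weight s₀ S t) (S ⟨t, h⟩) else weight s₀ S t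

open Classical in
/-- The set `I` of rounds at which the algorithm makes an update. -/
def updates {N T : ℕ} (s₀ : ℝ) (S : Fin T → Vec N × ℝ) : Finset (Fin T) :=
  Finset.univ.filter fun t => Errs s₀ (weight s₀ S t) (S t)

open Classical in
/-- The zero-one loss of the prediction `sgn (w · x)`: it is `1` exactly on a mistake. -/
def zeroOneLoss {N : ℕ} (s₀ : ℝ) (w : Vec N) (p : Vec N × ℝ) : ℝ :=
  if Errs s₀ w p then 1 else 0

open Classical in
/-- The zero-one loss of the real-valued score `w · x`: it is `1` exactly if `y (w · x) < 0`. -/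
def zeroOneScoreLoss {N : ℕ} (w : Vec N) (p : Vec N × ℝ) : ℝ :=
  if p.2 * inner ℝ w p.1 < 0 then 1 else 0

/-- The penalized empirical risk of the hypothesis used in round `i`, for the loss `L`. As rounds
are counted from `0`, the examples `i, …, T - 1` on which it is tested are `T - i` in number. -/
def penalizedRisk {N T : ℕ} (s₀ δ : ℝ) (L : Vec N → Vec N × ℝ → ℝ)
    (S : Fin T → Vec N × ℝ) (i : Fin T) : ℝ :=
  1 / ((T : ℝ) - (i : ℕ)) * ∑ t ∈ Finset.Ici i, L (weight s₀ S i) (S t)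
    + √(Real.log ((T : ℝ) * (T + 1) / δ) / (2 * ((T : ℝ) - (i : ℕ))))

/-- `ŵ` is a penalized risk minimizing Perceptron hypothesis (ties are broken arbitrarily). -/
def IsPenalizedRiskMinimizer {N T : ℕ} (s₀ δ : ℝ) (L : Vec N → Vec N × ℝ → ℝ)
    (S : Fin T → Vec N × ℝ) (w : Vec N) : Prop :=
  ∃ i : Fin T, (∀ j : Fin T, penalizedRisk s₀ δ L S i ≤ penalizedRisk s₀ δ L S j) ∧
    w = weight s₀ S i

/-- `γ`-admissible loss functions. -/
structure Admissible (γ : ℝ) (φ : ℝ → ℝ) : Prop where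
  gamma_pos : 0 < γ
  convex : ConvexOn ℝ Set.univ φ
  nonneg : ∀ x, 0 ≤ φ x
  pos_zero : 0 < φ 0
  lipschitz : ∀ x y, |φ x - φ y| ≤ γ * |x - y|

/-- The values over which the infimum in the bound is taken. The set is nonempty (take a hinge loss
and `u = 0`) and bounded below by `0`, so that its `sInf` is a genuine infimum. -/
def l1Bounds {N T : ℕ} (s₀ : ℝ) (S : Fin T → Vec N × ℝ) : Set ℝ :=
  {b | ∃ (γ : ℝ) (φ : ℝ → ℝ) (u : Vec N), Admissible γ φ ∧ ‖u‖ ≤ 1 ∧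
    b = (∑ t ∈ updates s₀ S, φ ((S t).2 * inner ℝ u (S t).1)) / (φ 0 * T)
      + γ * √(∑ t ∈ updates s₀ S, ‖(S t).1‖ ^ 2) / (φ 0 * T)}

end Perceptron

end

/-! ### Concentration for hypotheses chosen from past examples. -/

namespace OnlineToBatch

open ProbabilityTheory

/-! The vector `weight s₀ S i` depends only on the examples before round i. Hence its losses on
later examples, and the losses of all the vectors in their own rounds, become bounded martingale
differences once the risks are subtracted. Azuma's inequality and a union bound
(`exists_uniform_deviation`) give, off an event of probability at most δ, that every tail average
lies within its penalty c_i of the risk r_i, and that the sum of the r_t barely exceeds the online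
loss.

The rest is deterministic. Minimality gives r_i ≤ r_j + 2 c_j for the selected i and every j;
averaging over j (`risk_le_of_deviation`) bounds r_i by the online loss per round plus the deviation
term. The online loss is at most |I|, which `phi_zero_mul_card_updates_le` controls: Jensen replaces
the margins of u on I by their mean, the Lipschitz condition compares φ there with φ 0, and
Cauchy–Schwarz bounds the mean through the norm of the final weight vector. -/

/-- The induction step of Azuma: the bound on the inner integral is uniform in `a`, so by Fubini it
factors out of the outer one. -/
lemma hasSubgaussianMGF_prod {α β : Type*} [MeasurableSpace α] [MeasurableSpace β]
    {μ : Measure α} {ν : Measure β} [SFinite μ] [SFinite ν] {X : α → ℝ} {Y : α × β → ℝ}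
    {c c' : NNReal} (hXm : Measurable X) (hYm : Measurable Y) (hX : HasSubgaussianMGF X c μ)
    (hY : ∀ a, HasSubgaussianMGF (fun b => Y (a, b)) c' ν) :
    HasSubgaussianMGF (fun p : α × β => X p.1 + Y p) (c + c') (μ.prod ν) := by
  have key : ∀ t a, ∫ b, Real.exp (t * (X a + Y (a, b))) ∂ν ≤
      Real.exp (t * X a) * Real.exp (c' * t ^ 2 / 2) := by
    intro t a
    simp_rw [mul_add, Real.exp_add, integral_const_mul]
    exact mul_le_mul_of_nonneg_left ((hY a).mgf_le t) (Real.exp_pos _).le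
  have hmeas : ∀ t, Measurable fun p : α × β => Real.exp (t * (X p.1 + Y p)) := fun t => by
    fun_prop
  have hint : ∀ t, Integrable (fun p : α × β => Real.exp (t * (X p.1 + Y p))) (μ.prod ν) := by
    intro t
    rw [integrable_prod_iff (hmeas t).aestronglyMeasurable]
    refine ⟨.of_forall fun a => ?_, ?_⟩
    · simp_rw [mul_add, Real.exp_add]
      exact ((hY a).integrable_exp_mul t).const_mul _
    · refine ((hX.integrable_exp_mul t).mul_const (Real.exp (c' * t ^ 2 / 2))).mono'
        (hmeas t).aestronglyMeasurable.norm.integral_prod_right' (.of_forall fun a => ?_)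
      rw [Real.norm_of_nonneg (integral_nonneg fun _ => norm_nonneg _)]
      simpa only [Real.norm_of_nonneg (Real.exp_pos _).le] using key t a
  refine ⟨hint, fun t => ?_⟩
  calc mgf (fun p : α × β => X p.1 + Y p) (μ.prod ν) t
      = ∫ a, ∫ b, Real.exp (t * (X a + Y (a, b))) ∂ν ∂μ := integral_prod _ (hint t)
    _ ≤ ∫ a, Real.exp (t * X a) * Real.exp (c' * t ^ 2 / 2) ∂μ :=
        integral_mono (hint t).integral_prod_left ((hX.integrable_exp_mul t).mul_const _) (key t)
    _ = mgf X μ t * Real.exp (c' * t ^ 2 / 2) := integral_mul_const _ _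
    _ ≤ Real.exp (c * t ^ 2 / 2) * Real.exp (c' * t ^ 2 / 2) :=
        mul_le_mul_of_nonneg_right (hX.mgf_le t) (Real.exp_pos _).le
    _ = Real.exp ((c + c' : NNReal) * t ^ 2 / 2) := by
        rw [← Real.exp_add]; congr 1; push_cast; ring

/-- The first `m` examples of a sample of size `n`. -/
def pre {Z : Type*} {m n : ℕ} (h : m ≤ n) (S : Fin n → Z) : Fin m → Z :=
  fun j => S (Fin.castLE h j)

lemma measurable_pre {Z : Type*} [MeasurableSpace Z] {m n : ℕ} (h : m ≤ n) :
    Measurable (pre h : (Fin n → Z) → Fin m → Z) :=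
  measurable_pi_lambda _ fun _ => measurable_pi_apply _

variable {Z H : Type*} [MeasurableSpace Z] [MeasurableSpace H] {D : Measure Z}
  [IsProbabilityMeasure D]

/-- A sum of increments that are conditionally sub-Gaussian given the past examples is
sub-Gaussian. -/
theorem hasSubgaussianMGF_sum_pre {ξ : ∀ t : ℕ, (Fin t → Z) × Z → ℝ} {c : ℕ → NNReal}
    (hm : ∀ t, Measurable (ξ t)) (hξ : ∀ t p, HasSubgaussianMGF (fun z => ξ t (p, z)) (c t) D)
    (n : ℕ) :
    HasSubgaussianMGF (fun S : Fin n → Z => ∑ t : Fin n, ξ t (pre t.is_lt.le S, S t))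
      (∑ t : Fin n, c t) (Measure.pi fun _ => D) := by
  induction n with
  | zero => simp
  | succ n ih =>
    have hsum : Measurable fun S : Fin n → Z => ∑ t : Fin n, ξ t (pre t.is_lt.le S, S t) :=
      Finset.measurable_sum _ fun t _ =>
        (hm t).comp ((measurable_pre _).prodMk (measurable_pi_apply _))
    have hprod := hasSubgaussianMGF_prod hsum (hm n) ih (hξ n)
    -- The newest example is split off, and the swap puts the past first.
    have hmp := (Measure.measurePreserving_swap (μ := D)
      (ν := Measure.pi fun _ : Fin n => D)).comp
      (measurePreserving_piFinSuccAbove (fun _ : Fin (n + 1) => D) (Fin.last n))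
    rw [← hmp.map_eq] at hprod
    have := HasSubgaussianMGF.of_map hmp.measurable.aemeasurable hprod
    rw [Fin.sum_univ_castSucc]
    convert! this using 1
    funext S
    rw [Fin.sum_univ_castSucc]
    have hS : ((Prod.swap ∘ MeasurableEquiv.piFinSuccAbove (fun _ : Fin (n + 1) => Z)
        (Fin.last n)) S) = (pre n.le_succ S, S (Fin.last n)) := by
      refine Prod.ext (funext fun j => ?_) rfl
      simp [MeasurableEquiv.piFinSuccAbove, pre]
      rfl
    simp only [Function.comp_apply] at hS ⊢
    rw [hS]
    rfl

/-- Hoeffding--Azuma for the hypotheses `g t`, chosen before example `t` is seen and tested in the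
rounds `t` that satisfy `P`. -/
theorem measure_sqrt_le_sum_le {F : H → Z → ℝ} (hFm : Measurable (Function.uncurry F))
    (hF : ∀ w, HasSubgaussianMGF (F w) (1 / 4) D) {g : ∀ t : ℕ, (Fin t → Z) → H}
    (hg : ∀ t, Measurable (g t)) (P : ℕ → Prop) [DecidablePred P] {T n : ℕ}
    (hn : (Finset.univ.filter fun t : Fin T => P t).card = n) (hn0 : 0 < n) {A : ℝ} (hA : 0 ≤ A) :
    (Measure.pi fun _ : Fin T => D).real
      {S | √(n * A / 2) ≤
        ∑ t ∈ Finset.univ.filter fun t : Fin T => P t, F (g t (pre t.is_lt.le S)) (S t)} ≤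
      Real.exp (-A) := by
  have h := hasSubgaussianMGF_sum_pre (D := D)
    (ξ := fun t p => if P t then F (g t p.1) p.2 else 0) (c := fun t => if P t then 1 / 4 else 0)
    (fun t => by
      split_ifs
      · exact hFm.comp (((hg t).comp measurable_fst).prodMk measurable_snd)
      · exact measurable_const)
    (fun t p => by
      split_ifs
      · exact hF (g t p)
      · exact .fun_zero) T
  have h2 := h.measure_ge_le (Real.sqrt_nonneg (n * A / 2))
  simp only [← Finset.sum_filter] at h2
  refine h2.trans (Real.exp_le_exp.2 (le_of_eq ?_))
  -- The variance proxy is n/4, so the exponent is (nA/2) / (2 · n/4) = A.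
  rw [Finset.sum_const, hn, Real.sq_sqrt (by positivity)]
  have : (n : ℝ) ≠ 0 := by positivity
  simp only [nsmul_eq_mul]
  push_cast
  field_simp
  ring

/-- The expected loss of `w`. -/
noncomputable def risk (D : Measure Z) (L : H → Z → ℝ) (w : H) : ℝ := ∫ z, L w z ∂D

lemma measurable_risk {L : H → Z → ℝ} (hLm : Measurable (Function.uncurry L)) :
    Measurable (risk D L) :=
  (hLm.stronglyMeasurable.integral_prod_right (ν := D)).measurable

lemma hasSubgaussianMGF_loss_sub_risk {L : H → Z → ℝ} (hLm : Measurable (Function.uncurry L))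
    (hL : ∀ w z, L w z ∈ Set.Icc (0 : ℝ) 1) (w : H) :
    HasSubgaussianMGF (fun z => L w z - risk D L w) (1 / 4) D := by
  have := hasSubgaussianMGF_of_mem_Icc (μ := D) (X := L w) (a := 0) (b := 1)
    (hLm.comp measurable_prodMk_left).aemeasurable (.of_forall (hL w))
  convert! this using 1
  norm_num

/-- There are 2T + 1 bad events: two tails for each hypothesis, of probability at most δ/(T(T+1))
each, and one for the online sum, at most δ/(2(T+1)). -/
theorem exists_uniform_deviation {L : H → Z → ℝ} (hLm : Measurable (Function.uncurry L))
    (hL : ∀ w z, L w z ∈ Set.Icc (0 : ℝ) 1) {h : ∀ t : ℕ, (Fin t → Z) → H}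
    (hh : ∀ t, Measurable (h t)) {T : ℕ} (hT : 2 ≤ T) {δ : ℝ} (hδ : 0 < δ) (hδ1 : δ ≤ 1) :
    ∃ A : Set (Fin T → Z), MeasurableSet A ∧ 1 - δ ≤ (Measure.pi fun _ : Fin T => D).real A ∧
      ∀ S ∈ A,
        (∀ i : Fin T, |1 / ((T : ℝ) - (i : ℕ)) *
            ∑ t ∈ Finset.Ici i, L (h i (pre i.is_lt.le S)) (S t)
              - risk D L (h i (pre i.is_lt.le S))| ≤
          √(Real.log ((T : ℝ) * (T + 1) / δ) / (2 * ((T : ℝ) - (i : ℕ))))) ∧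
        ∑ t : Fin T, risk D L (h t (pre t.is_lt.le S)) ≤
          ∑ t : Fin T, L (h t (pre t.is_lt.le S)) (S t)
            + √((T : ℝ) * Real.log (2 * ((T : ℝ) + 1) / δ) / 2) := by
  have hT' : (2 : ℝ) ≤ T := by exact_mod_cast hT
  set a := Real.log ((T : ℝ) * (T + 1) / δ) with ha
  set b := Real.log (2 * ((T : ℝ) + 1) / δ) with hb
  have hea : Real.exp (-a) = δ / (T * (T + 1)) := by
    rw [Real.exp_neg, ha, Real.exp_log (by positivity), inv_div]
  have heb : Real.exp (-b) = δ / (2 * (T + 1)) := by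
    rw [Real.exp_neg, hb, Real.exp_log (by positivity), inv_div]
  have ha0 : 0 ≤ a := Real.log_nonneg (by rw [le_div_iff₀ hδ]; nlinarith)
  have hb0 : 0 ≤ b := Real.log_nonneg (by rw [le_div_iff₀ hδ]; nlinarith)
  let F : H → Z → ℝ := fun w z => L w z - risk D L w
  let G : H → Z → ℝ := fun w z => risk D L w - L w z
  have hrm : Measurable (risk D L) := measurable_risk hLm
  have hFm : Measurable (Function.uncurry F) := hLm.sub (hrm.comp measurable_fst)
  have hGm : Measurable (Function.uncurry G) := (hrm.comp measurable_fst).sub hLm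
  have hF : ∀ w, HasSubgaussianMGF (F w) (1 / 4) D := hasSubgaussianMGF_loss_sub_risk hLm hL
  have hG : ∀ w, HasSubgaussianMGF (G w) (1 / 4) D := fun w => by
    convert! (hF w).neg using 1
    funext z
    simp [F, G]
  -- Hypothesis `i` is frozen from round `i` on. Earlier rounds are never tested, so `h t p` is only
  -- a measurable filler.
  let g : ℕ → ∀ t : ℕ, (Fin t → Z) → H := fun i t p =>
    if hit : i ≤ t then h i (pre hit p) else h t p
  have hg : ∀ i t, Measurable (g i t) := fun i t => by
    by_cases hit : i ≤ t
    · simp only [g, hit, dif_pos]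
      exact (hh i).comp (measurable_pre hit)
    · simpa only [g, hit, dif_neg, not_false_eq_true] using hh t
  let bad (F : H → Z → ℝ) (i : Fin T) : Set (Fin T → Z) :=
    {S | √(((T - i : ℕ) : ℝ) * a / 2) ≤ ∑ t ∈ Finset.univ.filter fun t : Fin T => (i : ℕ) ≤ t,
      F (g i t (pre t.is_lt.le S)) (S t)}
  let badSum : Set (Fin T → Z) :=
    {S | √((T : ℝ) * b / 2) ≤ ∑ t ∈ Finset.univ.filter fun t : Fin T => True,
      G (h t (pre t.is_lt.le S)) (S t)}
  have hfilter : ∀ i : Fin T, (Finset.univ.filter fun t : Fin T => (i : ℕ) ≤ t) = Finset.Ici i :=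
    fun i => by ext t; simp
  have hbad : ∀ F : H → Z → ℝ, Measurable (Function.uncurry F) →
      (∀ w, HasSubgaussianMGF (F w) (1 / 4) D) → ∀ i,
      (Measure.pi fun _ : Fin T => D).real (bad F i) ≤ δ / (T * (T + 1)) := by
    intro F hFm hF i
    rw [← hea]
    exact measure_sqrt_le_sum_le hFm hF (hg i) (fun t => (i : ℕ) ≤ t)
      (by rw [hfilter, Fin.card_Ici]) (by omega) ha0
  have hbadSum : (Measure.pi fun _ : Fin T => D).real badSum ≤ δ / (2 * (T + 1)) := by
    rw [← heb]
    exact measure_sqrt_le_sum_le hGm hG hh (fun _ => True) (by simp) (by omega) hb0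
  have hbadm : ∀ F : H → Z → ℝ, Measurable (Function.uncurry F) → ∀ i,
      MeasurableSet (bad F i) := fun F hFm i =>
    measurableSet_le measurable_const (Finset.measurable_sum _ fun t _ =>
      hFm.comp (((hg i t).comp (measurable_pre _)).prodMk (measurable_pi_apply t)))
  have hbadSumm : MeasurableSet badSum :=
    measurableSet_le measurable_const (Finset.measurable_sum _ fun t _ =>
      hGm.comp (((hh t).comp (measurable_pre _)).prodMk (measurable_pi_apply t)))
  let B : Set (Fin T → Z) := ((⋃ i, bad F i) ∪ ⋃ i, bad G i) ∪ badSum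
  have hBm : MeasurableSet B :=
    ((MeasurableSet.iUnion (hbadm F hFm)).union (MeasurableSet.iUnion (hbadm G hGm))).union hbadSumm
  have hU : ∀ F : H → Z → ℝ, Measurable (Function.uncurry F) →
      (∀ w, HasSubgaussianMGF (F w) (1 / 4) D) →
      (Measure.pi fun _ : Fin T => D).real (⋃ i, bad F i) ≤ δ / (T + 1) := by
    intro F hFm hF
    refine (measureReal_iUnion_fintype_le _).trans
      ((Finset.sum_le_sum fun i _ => hbad F hFm hF i).trans (le_of_eq ?_))
    simp only [Finset.sum_const, Finset.card_univ, Fintype.card_fin, nsmul_eq_mul]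
    field_simp
  have hB : (Measure.pi fun _ : Fin T => D).real B ≤ δ := by
    have h1 := measureReal_union_le (μ := Measure.pi fun _ : Fin T => D)
      ((⋃ i, bad F i) ∪ ⋃ i, bad G i) badSum
    have h2 := measureReal_union_le (μ := Measure.pi fun _ : Fin T => D)
      (⋃ i, bad F i) (⋃ i, bad G i)
    -- The total 5δ/(2(T+1)) is at most δ precisely because T ≥ 2.
    have h3 : δ / (T + 1) + δ / (T + 1) + δ / (2 * (T + 1)) ≤ δ := by
      have : δ / (T + 1) + δ / (T + 1) + δ / (2 * (T + 1)) = δ * (5 / (2 * (T + 1))) := by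
        field_simp; ring
      rw [this]
      refine mul_le_of_le_one_right hδ.le ?_
      rw [div_le_one (by positivity)]
      linarith
    linarith [hU F hFm hF, hU G hGm hG]
  refine ⟨Bᶜ, hBm.compl, ?_, fun S hS => ⟨fun i => ?_, ?_⟩⟩
  · rw [probReal_compl_eq_one_sub hBm]
    linarith
  · have hn : (0 : ℝ) < (T : ℝ) - (i : ℕ) := by
      have : ((i : ℕ) : ℝ) < T := by exact_mod_cast i.is_lt
      linarith
    have hcast : (((T - i : ℕ) : ℕ) : ℝ) = (T : ℝ) - (i : ℕ) := Nat.cast_sub i.is_lt.le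
    have hsq : √(((T : ℝ) - (i : ℕ)) * a / 2) =
        ((T : ℝ) - (i : ℕ)) * √(a / (2 * ((T : ℝ) - (i : ℕ)))) := by
      rw [← Real.sqrt_sq hn.le, ← Real.sqrt_mul (sq_nonneg _), Real.sqrt_sq hn.le]
      congr 1
      field_simp
    have hgi : ∀ t ∈ Finset.Ici i, g i t (pre t.is_lt.le S) = h i (pre i.is_lt.le S) := by
      intro t ht
      have hit : (i : ℕ) ≤ t := Fin.le_def.1 (Finset.mem_Ici.1 ht)
      simp only [g, hit, dif_pos]
      rfl
    have hSF : S ∉ bad F i := fun hmem => hS (.inl (.inl (Set.mem_iUnion.2 ⟨i, hmem⟩)))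
    have hSG : S ∉ bad G i := fun hmem => hS (.inl (.inr (Set.mem_iUnion.2 ⟨i, hmem⟩)))
    have hcard : ((Finset.Ici i).card : ℝ) = (T : ℝ) - (i : ℕ) := by rw [Fin.card_Ici, hcast]
    simp only [bad, Set.mem_ofPred_eq, not_le, hfilter, hcast, hsq] at hSF hSG
    rw [Finset.sum_congr rfl fun t ht => by rw [hgi t ht]] at hSF hSG
    simp only [F, G, Finset.sum_sub_distrib, Finset.sum_const, nsmul_eq_mul, hcard] at hSF hSG
    set s := ∑ t ∈ Finset.Ici i, L (h i (pre i.is_lt.le S)) (S t)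
    set n := (T : ℝ) - (i : ℕ)
    have hmul : 1 / n * s * n = s := by field_simp
    rw [abs_le]
    constructor
    · by_contra! hlt
      nlinarith
    · by_contra! hlt
      nlinarith
  · have hSs : S ∉ badSum := fun hmem => hS (.inr hmem)
    simp only [badSum, Set.mem_ofPred_eq, not_le, Finset.filter_true, G,
      Finset.sum_sub_distrib] at hSs
    linarith

/-! ### Deterministic analysis of penalized selection. -/

lemma sum_one_div_sqrt_le (T : ℕ) :
    ∑ i : Fin T, 1 / √((T : ℝ) - (i : ℕ)) ≤ 2 * √(T : ℝ) := by
  have key : ∀ n : ℕ, ∑ k ∈ Finset.range n, 1 / √((k : ℝ) + 1) ≤ 2 * √(n : ℝ) := by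
    intro n
    induction n with
    | zero => simp
    | succ n ih =>
      rw [Finset.sum_range_succ]
      have h1 := Real.sq_sqrt (Nat.cast_nonneg (α := ℝ) n)
      have h2 := Real.sq_sqrt (show (0 : ℝ) ≤ n + 1 by positivity)
      have h3 : 0 < √((n : ℝ) + 1) := Real.sqrt_pos.2 (by positivity)
      -- This bound telescopes.
      have h4 : 1 / √((n : ℝ) + 1) ≤ 2 * √((n : ℝ) + 1) - 2 * √(n : ℝ) := by
        rw [div_le_iff₀ h3]
        nlinarith [sq_nonneg (√((n : ℝ) + 1) - √(n : ℝ))]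
      push_cast
      linarith
  refine le_trans (le_of_eq ?_) (key T)
  rw [← Fin.sum_univ_eq_sum_range (fun k => 1 / √((k : ℝ) + 1)), ← Equiv.sum_comp Fin.revPerm]
  refine Finset.sum_congr rfl fun i _ => ?_
  have : i.val + 1 ≤ T := i.is_lt
  rw [Fin.revPerm_apply, Fin.val_rev, Nat.cast_sub this]
  push_cast
  ring_nf

/-- Averaging over all j avoids singling out a best hypothesis. The penalties cost 4√(bT) and the
online deviation at most √(bT), within the allowed 6√(bT). -/
theorem risk_le_of_deviation {T : ℕ} (hT : 0 < T) {δ M : ℝ} (hδ : 0 < δ) (hδ1 : δ ≤ 1)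
    {e r : Fin T → ℝ} {i : Fin T}
    (hdev : ∀ i, |e i - r i| ≤ √(Real.log ((T : ℝ) * (T + 1) / δ) / (2 * ((T : ℝ) - (i : ℕ)))))
    (hsum : ∑ t, r t ≤ M + √((T : ℝ) * Real.log (2 * ((T : ℝ) + 1) / δ) / 2))
    (hi : ∀ j, e i + √(Real.log ((T : ℝ) * (T + 1) / δ) / (2 * ((T : ℝ) - (i : ℕ)))) ≤
      e j + √(Real.log ((T : ℝ) * (T + 1) / δ) / (2 * ((T : ℝ) - (j : ℕ))))) :
    r i ≤ M / T + 6 * √(1 / (T : ℝ) * Real.log (2 * ((T : ℝ) + 1) / δ)) := by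
  have hT' : (1 : ℝ) ≤ T := by exact_mod_cast hT
  -- Equivalent to T(T+1)/δ ≤ (2(T+1)/δ)²; it turns each penalty into at most √(b/(T-j)).
  have hab : Real.log ((T : ℝ) * (T + 1) / δ) ≤ 2 * Real.log (2 * ((T : ℝ) + 1) / δ) := by
    rw [← Nat.cast_two (R := ℝ), ← Real.log_pow, Nat.cast_two]
    refine Real.log_le_log (by positivity) ?_
    rw [div_pow, div_le_div_iff₀ hδ (by positivity)]
    have : (T : ℝ) * δ ≤ 4 * (T + 1) := by nlinarith
    nlinarith [mul_le_mul_of_nonneg_right this (show 0 ≤ (T + 1 : ℝ) * δ by positivity)]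
  set a := Real.log ((T : ℝ) * (T + 1) / δ)
  set b := Real.log (2 * ((T : ℝ) + 1) / δ)
  set c : Fin T → ℝ := fun i => √(a / (2 * ((T : ℝ) - (i : ℕ))))
  have hc : ∑ j, c j ≤ √b * (2 * √(T : ℝ)) := by
    refine le_trans ?_ (mul_le_mul_of_nonneg_left (sum_one_div_sqrt_le T) (Real.sqrt_nonneg b))
    rw [Finset.mul_sum]
    refine Finset.sum_le_sum fun j _ => ?_
    have hn : (0 : ℝ) < (T : ℝ) - (j : ℕ) := by
      have : ((j : ℕ) : ℝ) < T := by exact_mod_cast j.is_lt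
      linarith
    rw [mul_one_div, ← Real.sqrt_div' _ hn.le]
    refine Real.sqrt_le_sqrt ?_
    rw [div_le_div_iff₀ (by positivity) hn]
    nlinarith
  have hj : ∀ j, r i ≤ r j + 2 * c j := fun j => by
    have h1 := (abs_le.1 (hdev i)).1
    have h2 := (abs_le.1 (hdev j)).2
    have h3 := hi j
    simp only [c]
    linarith
  have hTr : T * r i ≤ ∑ j, r j + 2 * ∑ j, c j := by
    calc T * r i = ∑ _j : Fin T, r i := by simp
      _ ≤ ∑ j, (r j + 2 * c j) := Finset.sum_le_sum fun j _ => hj j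
      _ = _ := by rw [Finset.sum_add_distrib, Finset.mul_sum]
  have hhalf : √((T : ℝ) * b / 2) ≤ √b * √(T : ℝ) := by
    rw [← Real.sqrt_mul' _ (by positivity)]
    by_cases hb : 0 ≤ b
    · refine Real.sqrt_le_sqrt ?_
      nlinarith [mul_nonneg hb (show (0 : ℝ) ≤ T by positivity)]
    · rw [Real.sqrt_eq_zero_of_nonpos]
      · positivity
      · nlinarith
  have hsplit : √(1 / (T : ℝ) * b) * T = √b * √(T : ℝ) := by
    rw [Real.sqrt_mul (by positivity), Real.sqrt_div zero_le_one, Real.sqrt_one]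
    have h0 : √(T : ℝ) ≠ 0 := (Real.sqrt_pos.2 (by positivity)).ne'
    have h1 := Real.mul_self_sqrt (show (0 : ℝ) ≤ T by positivity)
    field_simp
    rw [pow_two, h1, mul_comm]
  have hnn : 0 ≤ √b * √(T : ℝ) := by positivity
  have hfin : T * r i ≤ M + 6 * (√b * √(T : ℝ)) := by linarith
  rw [← hsplit] at hfin
  have hTpos : (0 : ℝ) < T := by positivity
  have : M / T * T = M := by field_simp
  by_contra! hlt
  nlinarith

end OnlineToBatch

/-! ### The Perceptron: measurability, causality and the mistake bound. -/

namespace Perceptron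

open OnlineToBatch

variable {N T : ℕ} {s₀ : ℝ}

lemma measurable_sgn (s₀ : ℝ) : Measurable (sgn s₀) :=
  Measurable.ite measurableSet_Ioi measurable_const
    (Measurable.ite measurableSet_Iio measurable_const measurable_const)

lemma measurableSet_errs (s₀ : ℝ) :
    MeasurableSet {q : Vec N × (Vec N × ℝ) | Errs s₀ q.1 q.2} :=
  (measurableSet_eq_fun ((measurable_sgn s₀).comp
    (measurable_fst.inner measurable_snd.fst)) measurable_snd.snd).compl

lemma measurable_zeroOneLoss (s₀ : ℝ) :
    Measurable (Function.uncurry (zeroOneLoss (N := N) s₀)) :=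
  Measurable.ite (measurableSet_errs s₀) measurable_const measurable_const

lemma measurable_zeroOneScoreLoss :
    Measurable (Function.uncurry (zeroOneScoreLoss (N := N))) :=
  Measurable.ite (measurableSet_lt (measurable_snd.snd.mul
    (measurable_fst.inner measurable_snd.fst)) measurable_const) measurable_const measurable_const

lemma measurable_step {α : Type*} [MeasurableSpace α] {f : α → Vec N} {g : α → Vec N × ℝ}
    (hf : Measurable f) (hg : Measurable g) : Measurable fun a => step s₀ (f a) (g a) :=
  Measurable.ite (measurableSet_errs s₀ |>.preimage (hf.prodMk hg))
    (hf.add (hg.snd.smul hg.fst)) hf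

lemma measurable_weight (s₀ : ℝ) (t : ℕ) :
    Measurable fun S : Fin T → Vec N × ℝ => weight s₀ S t := by
  induction t with
  | zero => exact measurable_const
  | succ t ih =>
    by_cases h : t < T
    · simp only [weight, h, dif_pos]
      exact measurable_step ih (measurable_pi_apply _)
    · simpa only [weight, h, dif_neg, not_false_eq_true] using ih

/-- The weight vector used in round `t` depends on the earlier examples only. -/
lemma weight_pre (S : Fin T → Vec N × ℝ) {m : ℕ} (hm : m ≤ T) {t : ℕ} (ht : t ≤ m) :
    weight s₀ (pre hm S) t = weight s₀ S t := by
  induction t with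
  | zero => rfl
  | succ t ih =>
    have h1 : t < m := ht
    have h2 : t < T := h1.trans_le hm
    simp only [weight, h1, h2, dif_pos, ih h1.le]
    rfl

lemma errs_of_score_neg {w : Vec N} {p : Vec N × ℝ} (hp : p.2 = 1 ∨ p.2 = -1)
    (h : p.2 * inner ℝ w p.1 < 0) : Errs s₀ w p := by
  unfold Errs sgn
  rcases hp with hp | hp <;> rw [hp] at h ⊢
  · rw [if_neg (by linarith), if_pos (by linarith)]
    norm_num
  · rw [if_pos (by linarith)]
    norm_num

/-- The inequality is weak because a zero score may count as a mistake, depending on `s₀`. -/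
lemma score_nonpos_of_errs {w : Vec N} {p : Vec N × ℝ} (hp : p.2 = 1 ∨ p.2 = -1)
    (h : Errs s₀ w p) : p.2 * inner ℝ w p.1 ≤ 0 := by
  by_contra! hlt
  refine h ?_
  unfold sgn
  rcases hp with hp | hp <;> rw [hp] at hlt ⊢
  · rw [if_pos (by linarith)]
  · rw [if_neg (by linarith), if_pos (by linarith)]

lemma step_sub {w : Vec N} {p : Vec N × ℝ} [Decidable (Errs s₀ w p)] :
    step s₀ w p - w = if Errs s₀ w p then p.2 • p.1 else 0 := by
  unfold step
  split_ifs <;> simp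

/-- On a mistake the cross term 2y(w · x) is nonpositive, so only ‖x‖² is gained. -/
lemma norm_step_sq_sub_le {w : Vec N} {p : Vec N × ℝ} (hp : p.2 = 1 ∨ p.2 = -1)
    [Decidable (Errs s₀ w p)] :
    ‖step s₀ w p‖ ^ 2 - ‖w‖ ^ 2 ≤ if Errs s₀ w p then ‖p.1‖ ^ 2 else 0 := by
  unfold step
  split_ifs with h
  · have h1 := score_nonpos_of_errs hp h
    have h2 : ‖p.2 • p.1‖ ^ 2 = ‖p.1‖ ^ 2 := by
      rw [norm_smul]
      rcases hp with hp | hp <;> simp [hp]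
    rw [norm_add_sq_real, h2, inner_smul_right]
    linarith
  · simp

lemma weight_succ (S : Fin T → Vec N × ℝ) (t : Fin T) :
    weight s₀ S (t + 1) = step s₀ (weight s₀ S t) (S t) := by
  simp [weight]

lemma weight_eq_sum_updates (S : Fin T → Vec N × ℝ) :
    weight s₀ S T = ∑ t ∈ updates s₀ S, (S t).2 • (S t).1 := by
  classical
  have h := Finset.sum_range_sub (weight s₀ S) T
  rw [← Fin.sum_univ_eq_sum_range fun t => weight s₀ S (t + 1) - weight s₀ S t] at h
  simp only [weight_succ, step_sub] at h
  rw [← Finset.sum_filter] at h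
  simp only [weight, sub_zero] at h
  rw [← h]
  unfold updates
  congr!

lemma norm_weight_sq_le (S : Fin T → Vec N × ℝ) (hS : ∀ t, (S t).2 = 1 ∨ (S t).2 = -1) :
    ‖weight s₀ S T‖ ^ 2 ≤ ∑ t ∈ updates s₀ S, ‖(S t).1‖ ^ 2 := by
  classical
  have h := Finset.sum_range_sub (fun t => ‖weight s₀ S t‖ ^ 2) T
  rw [← Fin.sum_univ_eq_sum_range fun t => ‖weight s₀ S (t + 1)‖ ^ 2 - ‖weight s₀ S t‖ ^ 2] at h
  simp only [weight_succ] at h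
  have h0 : ‖weight s₀ S 0‖ ^ 2 = 0 := by simp [weight]
  rw [h0, sub_zero] at h
  rw [← h, updates, Finset.sum_filter]
  refine Finset.sum_le_sum fun t _ => ?_
  convert norm_step_sq_sub_le (s₀ := s₀) (w := weight s₀ S t) (hS t)

/-- The mistake bound of the Perceptron algorithm for admissible losses. -/
theorem phi_zero_mul_card_updates_le (S : Fin T → Vec N × ℝ)
    (hS : ∀ t, (S t).2 = 1 ∨ (S t).2 = -1) {γ : ℝ} {φ : ℝ → ℝ} (hφ : Admissible γ φ) {u : Vec N}
    (hu : ‖u‖ ≤ 1) :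
    φ 0 * (updates s₀ S).card ≤ ∑ t ∈ updates s₀ S, φ ((S t).2 * inner ℝ u (S t).1)
      + γ * √(∑ t ∈ updates s₀ S, ‖(S t).1‖ ^ 2) := by
  set I := updates s₀ S with hI
  rcases I.eq_empty_or_nonempty with h0 | h0
  · simp [h0]
  have hn : (0 : ℝ) < I.card := by exact_mod_cast h0.card_pos
  set m : ℝ := ∑ t ∈ I, (S t).2 * inner ℝ u (S t).1 with hm
  have hmw : m = inner ℝ u (weight s₀ S T) := by
    rw [weight_eq_sum_updates, inner_sum]
    simp only [inner_smul_right, hm, hI]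
  -- The absolute value is needed since φ need not be monotone.
  have hmle : |m| ≤ √(∑ t ∈ I, ‖(S t).1‖ ^ 2) := by
    rw [hmw]
    calc |inner ℝ u (weight s₀ S T)| ≤ ‖u‖ * ‖weight s₀ S T‖ := abs_real_inner_le_norm _ _
      _ ≤ ‖weight s₀ S T‖ := mul_le_of_le_one_left (norm_nonneg _) hu
      _ ≤ _ := Real.le_sqrt_of_sq_le (norm_weight_sq_le S hS)
  have hjensen : I.card * φ (m / I.card) ≤ ∑ t ∈ I, φ ((S t).2 * inner ℝ u (S t).1) := by
    have h := hφ.convex.map_sum_le (t := I) (w := fun _ => (I.card : ℝ)⁻¹)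
      (p := fun t => (S t).2 * inner ℝ u (S t).1) (fun _ _ => by positivity)
      (by rw [Finset.sum_const, nsmul_eq_mul, mul_inv_cancel₀ hn.ne']) (fun _ _ => trivial)
    simp only [smul_eq_mul, ← Finset.mul_sum] at h
    rw [← hm, inv_mul_eq_div, inv_mul_eq_div, le_div_iff₀ hn] at h
    linarith
  have hlip : I.card * (φ 0 - φ (m / I.card)) ≤ γ * |m| := by
    have h := (le_abs_self _).trans (hφ.lipschitz 0 (m / I.card))
    rw [zero_sub, abs_neg, abs_div, abs_of_pos hn, mul_div_assoc', le_div_iff₀ hn] at h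
    linarith
  have := mul_le_mul_of_nonneg_left hmle hφ.gamma_pos.le
  linarith

lemma admissible_hinge : Admissible 1 fun x => max (1 - x) 0 where
  gamma_pos := one_pos
  convex := ((convexOn_const 1 convex_univ).sub (concaveOn_id convex_univ)).sup
    (convexOn_const 0 convex_univ)
  nonneg x := le_max_right _ _
  pos_zero := by norm_num
  lipschitz x y := by
    refine (abs_max_sub_max_le_abs _ _ _).trans (le_of_eq ?_)
    rw [one_mul, abs_sub_comm x y]
    congr 1
    ring

lemma l1Bounds_nonempty (S : Fin T → Vec N × ℝ) : (l1Bounds s₀ S).Nonempty :=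
  ⟨_, 1, _, 0, admissible_hinge, by simp, rfl⟩

theorem card_updates_div_le_sInf_l1Bounds (S : Fin T → Vec N × ℝ)
    (hS : ∀ t, (S t).2 = 1 ∨ (S t).2 = -1) :
    ((updates s₀ S).card : ℝ) / T ≤ sInf (l1Bounds s₀ S) := by
  refine le_csInf (l1Bounds_nonempty S) ?_
  rintro b ⟨γ, φ, u, hφ, hu, rfl⟩
  rcases Nat.eq_zero_or_pos T with rfl | hT
  -- Division by T = 0 makes both sides 0.
  · simp
  · have hT' : (0 : ℝ) < T := by exact_mod_cast hT
    have := hφ.pos_zero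
    rw [← add_div, div_le_div_iff₀ hT' (by positivity)]
    nlinarith [mul_le_mul_of_nonneg_right (phi_zero_mul_card_updates_le (s₀ := s₀) S hS hφ hu)
      hT'.le]

lemma sInf_l1Bounds_nonneg (S : Fin T → Vec N × ℝ) : 0 ≤ sInf (l1Bounds s₀ S) := by
  refine Real.sInf_nonneg ?_
  rintro b ⟨γ, φ, u, hφ, hu, rfl⟩
  have := hφ.pos_zero
  have := hφ.gamma_pos
  have := Finset.sum_nonneg fun t (_ : t ∈ updates s₀ S) => hφ.nonneg ((S t).2 * inner ℝ u (S t).1)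
  positivity

/-- What the risk bound needs from a loss function: it lies between the two zero-one losses. -/
structure IsZeroOneType (s₀ : ℝ) (L : Vec N → Vec N × ℝ → ℝ) : Prop where
  measurable : Measurable (Function.uncurry L)
  mem_Icc : ∀ w p, L w p ∈ Set.Icc (0 : ℝ) 1
  score_le : ∀ w p, (p.2 = 1 ∨ p.2 = -1) → zeroOneScoreLoss w p ≤ L w p
  le_zeroOne : ∀ w p, (p.2 = 1 ∨ p.2 = -1) → L w p ≤ zeroOneLoss s₀ w p

lemma zeroOneLoss_mem_Icc (s₀ : ℝ) (w : Vec N) (p : Vec N × ℝ) :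
    zeroOneLoss s₀ w p ∈ Set.Icc (0 : ℝ) 1 := by
  unfold zeroOneLoss; split_ifs <;> simp

lemma zeroOneScoreLoss_mem_Icc (w : Vec N) (p : Vec N × ℝ) :
    zeroOneScoreLoss w p ∈ Set.Icc (0 : ℝ) 1 := by
  unfold zeroOneScoreLoss; split_ifs <;> simp

lemma zeroOneScoreLoss_le_zeroOneLoss {w : Vec N} {p : Vec N × ℝ} (hp : p.2 = 1 ∨ p.2 = -1) :
    zeroOneScoreLoss w p ≤ zeroOneLoss s₀ w p := by
  by_cases h : p.2 * inner ℝ w p.1 < 0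
  · rw [zeroOneScoreLoss, zeroOneLoss, if_pos h, if_pos (errs_of_score_neg hp h)]
  · rw [zeroOneScoreLoss, if_neg h]
    exact (zeroOneLoss_mem_Icc s₀ w p).1

lemma isZeroOneType_of_eq {L : Vec N → Vec N × ℝ → ℝ}
    (hL : L = zeroOneLoss s₀ ∨ L = zeroOneScoreLoss) : IsZeroOneType s₀ L := by
  rcases hL with rfl | rfl
  · exact ⟨measurable_zeroOneLoss s₀, zeroOneLoss_mem_Icc s₀,
      fun _ _ => zeroOneScoreLoss_le_zeroOneLoss, fun _ _ _ => le_rfl⟩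
  · exact ⟨measurable_zeroOneScoreLoss, zeroOneScoreLoss_mem_Icc,
      fun _ _ _ => le_rfl, fun _ _ => zeroOneScoreLoss_le_zeroOneLoss⟩

/-! ### From deviations and mistakes to the risk bound. -/

variable {D : Measure (Vec N × ℝ)} [IsProbabilityMeasure D] {L : Vec N → Vec N × ℝ → ℝ}

lemma measureReal_score_neg_le_risk (hD : ∀ᵐ p ∂D, p.2 = 1 ∨ p.2 = -1) (hL : IsZeroOneType s₀ L)
    (w : Vec N) : D.real {p | p.2 * inner ℝ w p.1 < 0} ≤ risk D L w := by
  classical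
  have hm : MeasurableSet {p : Vec N × ℝ | p.2 * inner ℝ w p.1 < 0} :=
    measurableSet_lt (measurable_snd.mul (measurable_const.inner measurable_fst)) measurable_const
  have hint : ∀ {f : Vec N × ℝ → ℝ}, Measurable f → (∀ p, f p ∈ Set.Icc (0 : ℝ) 1) →
      Integrable f D := fun hf h01 => Integrable.of_mem_Icc 0 1 hf.aemeasurable (.of_forall h01)
  have heq : D.real {p | p.2 * inner ℝ w p.1 < 0} = ∫ p, zeroOneScoreLoss w p ∂D := by
    rw [← integral_indicator_one hm]
    refine integral_congr_ae (.of_forall fun p => ?_)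
    simp [Set.indicator_apply, zeroOneScoreLoss]
  rw [heq]
  refine integral_mono_ae (hint (measurable_zeroOneScoreLoss.comp measurable_prodMk_left)
    (zeroOneScoreLoss_mem_Icc w)) (hint (hL.measurable.comp measurable_prodMk_left)
    (hL.mem_Icc w)) ?_
  filter_upwards [hD] with p hp using hL.score_le w p hp

lemma sum_loss_le_card_updates (hL : IsZeroOneType s₀ L) (S : Fin T → Vec N × ℝ)
    (hS : ∀ t, (S t).2 = 1 ∨ (S t).2 = -1) :
    ∑ t : Fin T, L (weight s₀ S t) (S t) ≤ (updates s₀ S).card := by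
  classical
  calc ∑ t : Fin T, L (weight s₀ S t) (S t)
      ≤ ∑ t : Fin T, zeroOneLoss s₀ (weight s₀ S t) (S t) :=
        Finset.sum_le_sum fun t _ => hL.le_zeroOne _ _ (hS t)
    _ = (updates s₀ S).card := by simp [zeroOneLoss, updates, Finset.sum_boole]

theorem exists_risk_bound (hD : ∀ᵐ p ∂D, p.2 = 1 ∨ p.2 = -1) (hL : IsZeroOneType s₀ L)
    (hT : 2 ≤ T) {δ : ℝ} (hδ : 0 < δ) (hδ1 : δ ≤ 1) :
    ∃ A : Set (Fin T → Vec N × ℝ), MeasurableSet A ∧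
      1 - δ ≤ (Measure.pi fun _ : Fin T => D).real A ∧
      ∀ S ∈ A, ∀ w : Vec N, IsPenalizedRiskMinimizer s₀ δ L S w →
        D.real {p | p.2 * inner ℝ w p.1 < 0} ≤ sInf (l1Bounds s₀ S)
          + 6 * √(1 / (T : ℝ) * Real.log (2 * ((T : ℝ) + 1) / δ)) := by
  obtain ⟨A, hAm, hA, hdev⟩ := exists_uniform_deviation (D := D) hL.measurable hL.mem_Icc
    (h := fun t (p : Fin t → Vec N × ℝ) => weight s₀ p t) (fun t => measurable_weight s₀ t)
    hT hδ hδ1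
  simp only [weight_pre _ _ le_rfl] at hdev
  have hlab : MeasurableSet {p : Vec N × ℝ | p.2 = 1 ∨ p.2 = -1} :=
    (measurableSet_eq_fun measurable_snd measurable_const).union
      (measurableSet_eq_fun measurable_snd measurable_const)
  have hlabs : ∀ᵐ S ∂(Measure.pi fun _ : Fin T => D), ∀ t, (S t).2 = 1 ∨ (S t).2 = -1 :=
    ae_all_iff.2 fun t =>
      (measurePreserving_eval (fun _ : Fin T => D) t).quasiMeasurePreserving.ae hD
  -- The mistake bound is pathwise and needs labels ±1 in every round; imposing this removes only a
  -- null set.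
  refine ⟨A ∩ {S | ∀ t, (S t).2 = 1 ∨ (S t).2 = -1}, hAm.inter ?_, ?_, ?_⟩
  · rw [Set.ofPred_forall]
    exact MeasurableSet.iInter fun t => hlab.preimage (measurable_pi_apply t)
  · refine hA.trans (le_of_eq (measureReal_congr ?_))
    filter_upwards [hlabs] with S hS
    exact propext ⟨fun h => ⟨h, hS⟩, fun h => h.1⟩
  · rintro S ⟨hSA, hS⟩ w ⟨i, hi, rfl⟩
    obtain ⟨h1, h2⟩ := hdev S hSA
    have hT' : (0 : ℝ) < T := by positivity
    refine (measureReal_score_neg_le_risk hD hL _).trans ((risk_le_of_deviation (by omega) hδ hδ1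
      (r := fun t => risk D L (weight s₀ S t)) h1 h2 hi).trans ?_)
    gcongr
    exact (div_le_div_of_nonneg_right (sum_loss_le_card_updates hL S hS) hT'.le).trans
      (card_updates_div_le_sInf_l1Bounds S hS)

end Perceptron

theorem corollary3 (N T : ℕ) (D : Measure (Perceptron.Vec N × ℝ)) [IsProbabilityMeasure D]
    (hD : ∀ᵐ p ∂D, p.2 = 1 ∨ p.2 = -1) (s₀ : ℝ)
    (L : Perceptron.Vec N → Perceptron.Vec N × ℝ → ℝ)
    (hL : L = Perceptron.zeroOneLoss s₀ ∨ L = Perceptron.zeroOneScoreLoss)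
    (δ : ℝ) (hδ : 0 < δ) :
    ∃ A : Set (Fin T → Perceptron.Vec N × ℝ), MeasurableSet A ∧
      1 - δ ≤ (Measure.pi fun _ : Fin T => D).real A ∧
      ∀ S ∈ A, ∀ w : Perceptron.Vec N, Perceptron.IsPenalizedRiskMinimizer s₀ δ L S w →
        D.real {p | p.2 * inner ℝ w p.1 < 0} ≤
          sInf (Perceptron.l1Bounds s₀ S)
            + 6 * √(1 / (T : ℝ) * Real.log (2 * ((T : ℝ) + 1) / δ)) := by
  rcases le_or_gt δ 1 with hδ1 | hδ1
  · rcases le_or_gt 2 T with hT | hT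
    · exact Perceptron.exists_risk_bound hD (Perceptron.isZeroOneType_of_eq hL) hT hδ hδ1
    · -- With at most one round, the only hypothesis is `0`, whose score is never negative.
      refine ⟨Set.univ, MeasurableSet.univ, by simp [hδ.le], fun S _ w hw => ?_⟩
      obtain ⟨i, -, rfl⟩ := hw
      have hi : (i : ℕ) = 0 := by omega
      have := Perceptron.sInf_l1Bounds_nonneg (s₀ := s₀) S
      simp only [hi, Perceptron.weight, inner_zero_left, mul_zero, lt_self_iff_false,
        Set.ofPred_false, measureReal_empty]
      positivity
  -- Here 1 - δ < 0, so the empty event suffices.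
  · exact ⟨∅, MeasurableSet.empty, by simp [hδ1.le], fun S hS => hS.elim⟩
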